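/- Let $M$ be a smooth manifold of dimension $2n+1$ with an almost contact B-metric structure $(\varphi,\xi,\eta,g)$: $\varphi$ is a smooth field of endomorphisms of $TM$, $\xi$ a smooth vector field, $\eta$ a smooth 1-form and $g$ a smooth pseudo-Riemannian metric of signature $(n+1,n)$ such that \[ \varphi\xi=0,\quad \varphi^2=-\mathrm{id}+\eta\otimes\xi,\quad \eta\circ\varphi=0,\quad \eta(\xi)=1,\quad g(\varphi x,\varphi y)=-g(x,y)+\eta(x)\eta(y). \] Let $\nabla$ be the Levi-Civita connection of $g$, let $\rho$ be its Ricci tensor, $\rho(y,z)=\operatorname{trace}(x\mapsto R(x,y)z)$ with $R(x,y)=[\nabla_x,\nabla_y]-\nabla_{[x,y]}$, and let $\tilde g(x,y)=g(x,\varphi y)+\eta(x)\eta(y)$ be the associated metric. Suppose that $M$ is Einstein-like with constants $(a,b,c)\in\mathbb{R}^3$, that is, \[ \rho(x,y)=a\,g(x,y)+b\,\tilde g(x,y)+c\,\eta(x)\eta(y) \] for all $x,y$. Then for all tangent vectors $x,y$ at any point of $M$ \[ \rho(\varphi x,\varphi y)=-\rho(x,y)+(a+b+c)\eta(x)\eta(y),\qquad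 \rho(\varphi x,y)=\rho(x,\varphi y),\qquad \rho(\varphi x,\xi)=0, \] \[ \rho(x,\xi)=(a+b+c)\eta(x),\qquad \rho(\xi,\xi)=a+b+c, \] and for every tangent vector $x$ at a point $p$ and all vector fields $y,z$ differentiable at $p$ \[ (\nabla_x\rho)(y,z)=b\,g\bigl((\nabla_x\varphi)y,z\bigr)+(b+c)\bigl\{g(\nabla_x\xi,y)\eta(z)+g(\nabla_x\xi,z)\eta(y)\bigr\}\quad\text{at } p. \] -/

import Mathlib

open Bundle FiberBundle VectorField
open scoped Manifold ContDiff Topology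

noncomputable section

section PseudoRiemannian

variable {E : Type*} [NormedAddCommGroup E] [NormedSpace ℝ E] [FiniteDimensional ℝ E]
  {H : Type*} [TopologicalSpace H] (I : ModelWithCorners ℝ E H)
  (M : Type*) [TopologicalSpace M] [ChartedSpace H M] [IsManifold I ∞ M]

/-- A smooth pseudo-Riemannian metric on `M`: a smooth field of nondegenerate symmetric bilinear
forms on the tangent spaces. -/
structure PseudoRiemannianMetric where
  inner (p : M) : TangentSpace I p →L[ℝ] TangentSpace I p →L[ℝ] ℝ
  symm (p : M) (x y : TangentSpace I p) : inner p x y = inner p y x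
  nondegenerate (p : M) (x : TangentSpace I p) (hx : ∀ y, inner p x y = 0) : x = 0
  contMDiff : ContMDiff I (I.prod 𝓘(ℝ, E →L[ℝ] E →L[ℝ] ℝ)) ∞
    (fun p ↦ TotalSpace.mk' (E →L[ℝ] E →L[ℝ] ℝ)
      (E := fun p : M ↦ (TangentSpace I p →L[ℝ] TangentSpace I p →L[ℝ] ℝ)) p (inner p))

namespace PseudoRiemannianMetric

variable {I M} (g : PseudoRiemannianMetric I M)

/-- The quadratic form `x ↦ g(x, x)` on a tangent space. -/
def quadraticForm (p : M) : QuadraticForm ℝ (TangentSpace I p) :=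
  LinearMap.BilinMap.toQuadraticMap
    ((ContinuousLinearMap.coeLM ℝ).comp (g.inner p).toLinearMap)

/-- The metric has signature `(r, s)` at every point. -/
def HasSignature (r s : ℕ) : Prop :=
  ∀ p : M, sigPos (g.quadraticForm p) = r ∧ sigNeg (g.quadraticForm p) = s

theorem mdifferentiableAt_inner {p : M} {X Y : Π p : M, TangentSpace I p}
    (hX : MDiffAt (T% X) p) (hY : MDiffAt (T% Y) p) :
    MDiffAt (fun q ↦ g.inner q (X q) (Y q)) p := by
  have : MDifferentiableAt I (I.prod 𝓘(ℝ)) (fun m ↦ TotalSpace.mk' ℝ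
      (E := Bundle.Trivial M ℝ) m (g.inner m (X m) (Y m))) p := by
    apply MDifferentiableAt.clm_bundle_apply₂ (F₁ := E) (F₂ := E)
    · exact g.contMDiff.mdifferentiableAt (by simp)
    · exact hX
    · exact hY
  simp only [mdifferentiableAt_totalSpace] at this
  exact this.2

/-- The isomorphism `x ↦ g(x, ·)` of a tangent space with its dual. -/
def flat (p : M) : TangentSpace I p ≃L[ℝ] (TangentSpace I p →L[ℝ] ℝ) :=
  haveI : FiniteDimensional ℝ (TangentSpace I p) := inferInstanceAs (FiniteDimensional ℝ E)
  haveI : T2Space (TangentSpace I p) := inferInstanceAs (T2Space E)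
  haveI : FiniteDimensional ℝ (TangentSpace I p →L[ℝ] ℝ) :=
    inferInstanceAs (FiniteDimensional ℝ (E →L[ℝ] ℝ))
  LinearEquiv.toContinuousLinearEquiv <|
    LinearMap.linearEquivOfInjective (g.inner p).toLinearMap
      (by
        rw [← LinearMap.ker_eq_bot, LinearMap.ker_eq_bot']
        intro x hx
        exact g.nondegenerate p x fun y ↦ congrArg (fun f ↦ f y) hx)
      (by
        change Module.finrank ℝ E = Module.finrank ℝ (E →L[ℝ] ℝ)
        rw [← Subspace.dual_finrank_eq (K := ℝ) (V := E)]
        exact (LinearMap.toContinuousLinearMap (𝕜 := ℝ) (E := E) (F' := ℝ)).finrank_eq)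

@[simp]
theorem flat_apply (p : M) (x y : TangentSpace I p) : g.flat p x y = g.inner p x y := rfl

@[simp]
theorem inner_flat_symm (p : M) (α : TangentSpace I p →L[ℝ] ℝ) (y : TangentSpace I p) :
    g.inner p ((g.flat p).symm α) y = α y := by
  rw [← flat_apply, ContinuousLinearEquiv.apply_symm_apply]

/-- The right-hand side of the Koszul formula for `2 g(∇_X Y, Z)`. -/
def koszul (Y X Z : Π p : M, TangentSpace I p) (p : M) : ℝ :=
  d% (fun q ↦ g.inner q (Y q) (Z q)) p (X p)
    + d% (fun q ↦ g.inner q (X q) (Z q)) p (Y p)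
    - d% (fun q ↦ g.inner q (X q) (Y q)) p (Z p)
    + g.inner p (mlieBracket I X Y p) (Z p)
    - g.inner p (mlieBracket I X Z p) (Y p)
    - g.inner p (mlieBracket I Y Z p) (X p)

theorem koszul_tensorial_left {p : M} {Y Z : Π p : M, TangentSpace I p}
    (hY : MDiffAt (T% Y) p) (hZ : MDiffAt (T% Z) p) :
    TensorialAt I E (g.koszul Y · Z p) p where
  smul {f X} hf hX := by
    have : CompleteSpace E := FiniteDimensional.complete ℝ E
    simp [koszul, mlieBracket_smul_left hf hX, mvfderiv_fun_mul hf (g.mdifferentiableAt_inner hX hZ),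
      mvfderiv_fun_mul hf (g.mdifferentiableAt_inner hX hY)]
    ring
  add {X X'} hX hX' := by
    have : CompleteSpace E := FiniteDimensional.complete ℝ E
    simp [koszul, mlieBracket_add_left hX hX',
      mvfderiv_fun_add (g.mdifferentiableAt_inner hX hZ) (g.mdifferentiableAt_inner hX' hZ),
      mvfderiv_fun_add (g.mdifferentiableAt_inner hX hY) (g.mdifferentiableAt_inner hX' hY)]
    ring

theorem koszul_tensorial_right {p : M} {Y X : Π p : M, TangentSpace I p}
    (hY : MDiffAt (T% Y) p) (hX : MDiffAt (T% X) p) :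
    TensorialAt I E (g.koszul Y X · p) p where
  smul {f Z} hf hZ := by
    have : CompleteSpace E := FiniteDimensional.complete ℝ E
    simp [koszul, mlieBracket_smul_right hf hZ, mvfderiv_fun_mul hf (g.mdifferentiableAt_inner hX hZ),
      mvfderiv_fun_mul hf (g.mdifferentiableAt_inner hY hZ), g.symm p (Z p)]
    ring
  add {Z Z'} hZ hZ' := by
    have : CompleteSpace E := FiniteDimensional.complete ℝ E
    simp [koszul, mlieBracket_add_right hZ hZ',
      mvfderiv_fun_add (g.mdifferentiableAt_inner hX hZ) (g.mdifferentiableAt_inner hX hZ'),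
      mvfderiv_fun_add (g.mdifferentiableAt_inner hY hZ) (g.mdifferentiableAt_inner hY hZ')]
    ring

open Classical in
/-- The map `x ↦ ∇_x Y` determined by the Koszul formula, for a vector field `Y` that is
differentiable at the point (and `0` by convention otherwise). -/
def leviCivitaFun (Y : Π p : M, TangentSpace I p) (p : M) :
    TangentSpace I p →L[ℝ] TangentSpace I p :=
  if hY : MDiffAt (T% Y) p then
    (g.flat p).symm.toContinuousLinearMap ∘L
      ((1 / 2 : ℝ) • TensorialAt.mkHom₂ (fun X Z ↦ g.koszul Y X Z p) p
        (fun _ hZ ↦ g.koszul_tensorial_left hY hZ) (fun _ hX ↦ g.koszul_tensorial_right hY hX))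
  else 0

theorem two_mul_inner_leviCivitaFun {p : M} {X Y Z : Π p : M, TangentSpace I p}
    (hX : MDiffAt (T% X) p) (hY : MDiffAt (T% Y) p) (hZ : MDiffAt (T% Z) p) :
    2 * g.inner p (g.leviCivitaFun Y p (X p)) (Z p) = g.koszul Y X Z p := by
  have h := TensorialAt.mkHom₂_apply (Φ := fun X Z ↦ g.koszul Y X Z p)
    (fun _ hZ ↦ g.koszul_tensorial_left hY hZ) (fun _ hX ↦ g.koszul_tensorial_right hY hX) hX hZ
  simp only [leviCivitaFun, dif_pos hY]
  simp [h]

theorem ext_inner {p : M} {x x' : TangentSpace I p}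
    (h : ∀ Z : Π p : M, TangentSpace I p, MDiffAt (T% Z) p →
      g.inner p x (Z p) = g.inner p x' (Z p)) : x = x' := by
  rw [← sub_eq_zero]
  refine g.nondegenerate p _ fun y ↦ ?_
  have := h (extend E y) (mdifferentiableAt_extend I E y)
  simp only [extend_apply_self] at this
  simp [this]

/-- The Levi-Civita connection of a pseudo-Riemannian metric, given by the Koszul formula. The
lemmas below show that it is torsion-free and metric. As in Mathlib, `g.leviCivita Y p x` is
`∇_x Y` for `x : TangentSpace I p`. -/
def leviCivita : CovariantDerivative I E (TangentSpace I : M → Type _) where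
  toFun := g.leviCivitaFun
  isCovariantDerivativeOnUniv :=
    { add := by
        intro Y Y' p hY hY' _
        ext x
        refine g.ext_inner fun Z hZ ↦ ?_
        have hX := mdifferentiableAt_extend I E x
        have hS : MDiffAt (T% (Y + Y')) p := mdifferentiableAt_add_section hY hY'
        have : CompleteSpace E := FiniteDimensional.complete ℝ E
        have h1 := g.two_mul_inner_leviCivitaFun hX hY hZ
        have h2 := g.two_mul_inner_leviCivitaFun hX hY' hZ
        have h3 := g.two_mul_inner_leviCivitaFun hX hS hZ
        simp only [extend_apply_self] at h1 h2 h3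
        have h4 : g.koszul (Y + Y') (extend E x) Z p
            = g.koszul Y (extend E x) Z p + g.koszul Y' (extend E x) Z p := by
          simp [koszul, mlieBracket_add_right hY hY', mlieBracket_add_left hY hY',
            mvfderiv_fun_add (g.mdifferentiableAt_inner hY hZ) (g.mdifferentiableAt_inner hY' hZ),
            mvfderiv_fun_add (g.mdifferentiableAt_inner hX hY) (g.mdifferentiableAt_inner hX hY')]
          ring
        simp only [_root_.add_apply, map_add]
        linarith
      leibniz := by
        intro Y f p hY hf _
        ext x
        refine g.ext_inner fun Z hZ ↦ ?_
        have hX := mdifferentiableAt_extend I E x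
        have hS : MDiffAt (T% (f • Y)) p := hf.smul_section hY
        have : CompleteSpace E := FiniteDimensional.complete ℝ E
        have h1 := g.two_mul_inner_leviCivitaFun hX hY hZ
        have h3 := g.two_mul_inner_leviCivitaFun hX hS hZ
        simp only [extend_apply_self] at h1 h3
        have h4 : g.koszul (f • Y) (extend E x) Z p
            = f p * g.koszul Y (extend E x) Z p + 2 * (d% f p x * g.inner p (Y p) (Z p)) := by
          simp [koszul, mlieBracket_smul_right hf hY, mlieBracket_smul_left hf hY,
            mvfderiv_fun_mul hf (g.mdifferentiableAt_inner hY hZ),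
            mvfderiv_fun_mul hf (g.mdifferentiableAt_inner hX hY), g.symm p x (Y p)]
          ring
        simp
        linear_combination (1 / 2) * h3 - (1 / 2) * f p * h1 + (1 / 2) * h4 }

/-- The Levi-Civita connection is torsion-free. -/
theorem leviCivita_torsion_free {p : M} {X Y : Π p : M, TangentSpace I p}
    (hX : MDiffAt (T% X) p) (hY : MDiffAt (T% Y) p) :
    g.leviCivita Y p (X p) - g.leviCivita X p (Y p) = mlieBracket I X Y p := by
  refine g.ext_inner fun Z hZ ↦ ?_
  have h1 : 2 * g.inner p (g.leviCivita Y p (X p)) (Z p) = g.koszul Y X Z p :=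
    g.two_mul_inner_leviCivitaFun hX hY hZ
  have h2 : 2 * g.inner p (g.leviCivita X p (Y p)) (Z p) = g.koszul X Y Z p :=
    g.two_mul_inner_leviCivitaFun hY hX hZ
  have h3 : (fun q ↦ g.inner q (X q) (Y q)) = fun q ↦ g.inner q (Y q) (X q) :=
    funext fun q ↦ g.symm q _ _
  have h4 : mlieBracket I Y X p = - mlieBracket I X Y p := mlieBracket_swap_apply
  simp only [koszul, h3, h4, map_neg, _root_.neg_apply] at h1 h2
  simp only [map_sub, _root_.sub_apply]
  linarith

/-- The Levi-Civita connection is compatible with the metric. -/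
theorem leviCivita_metric {p : M} {Y Z : Π p : M, TangentSpace I p}
    (hY : MDiffAt (T% Y) p) (hZ : MDiffAt (T% Z) p) (x : TangentSpace I p) :
    d% (fun q ↦ g.inner q (Y q) (Z q)) p x
      = g.inner p (g.leviCivita Y p x) (Z p) + g.inner p (Y p) (g.leviCivita Z p x) := by
  have hX := mdifferentiableAt_extend I E x
  have h1 : 2 * g.inner p (g.leviCivita Y p (extend E x p)) (Z p) = g.koszul Y (extend E x) Z p :=
    g.two_mul_inner_leviCivitaFun hX hY hZ
  have h2 : 2 * g.inner p (g.leviCivita Z p (extend E x p)) (Y p) = g.koszul Z (extend E x) Y p :=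
    g.two_mul_inner_leviCivitaFun hX hZ hY
  have h3 : (fun q ↦ g.inner q (Z q) (Y q)) = fun q ↦ g.inner q (Y q) (Z q) :=
    funext fun q ↦ g.symm q _ _
  have h4 : mlieBracket I Z Y p = - mlieBracket I Y Z p := mlieBracket_swap_apply
  simp only [koszul, h3, h4, map_neg, _root_.neg_apply, extend_apply_self] at h1 h2
  rw [g.symm p (Y p)]
  linarith

/-- The curvature `R(X, Y)Z = ∇_X ∇_Y Z - ∇_Y ∇_X Z - ∇_{[X, Y]} Z` of the Levi-Civita
connection. -/
def curvature (X Y Z : Π p : M, TangentSpace I p) (p : M) : TangentSpace I p :=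
  g.leviCivita (fun q ↦ g.leviCivita Z q (Y q)) p (X p)
    - g.leviCivita (fun q ↦ g.leviCivita Z q (X q)) p (Y p)
    - g.leviCivita Z p (mlieBracket I X Y p)

/-- The Ricci tensor `ρ(y, z) = trace (x ↦ R(x, y)z)`, the trace being computed in a basis of the
tangent space. The tensor `R` is evaluated on tangent vectors at `p` by means of extensions of these
vectors that are smooth near `p` (the ones that are constant in the preferred local trivialization
of the tangent bundle at `p`). -/
def ricci (p : M) (y z : TangentSpace I p) : ℝ :=
  haveI : FiniteDimensional ℝ (TangentSpace I p) := inferInstanceAs (FiniteDimensional ℝ E)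
  ∑ i, (Module.finBasis ℝ (TangentSpace I p)).repr
    (g.curvature (extend E (Module.finBasis ℝ (TangentSpace I p) i)) (extend E y) (extend E z) p) i

/-- The covariant derivative `(∇_x φ)Y = ∇_x (φ Y) - φ (∇_x Y)` of a field of endomorphisms. -/
def covDerivEnd (φ : Π p : M, TangentSpace I p →L[ℝ] TangentSpace I p)
    (Y : Π p : M, TangentSpace I p) (p : M) (x : TangentSpace I p) : TangentSpace I p :=
  g.leviCivita (fun q ↦ φ q (Y q)) p x - φ p (g.leviCivita Y p x)

/-- The covariant derivative `(∇_x T)(Y, Z) = x (T(Y, Z)) - T(∇_x Y, Z) - T(Y, ∇_x Z)` of a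
`(0,2)`-tensor field. -/
def covDerivBilin (T : Π p : M, TangentSpace I p → TangentSpace I p → ℝ)
    (Y Z : Π p : M, TangentSpace I p) (p : M) (x : TangentSpace I p) : ℝ :=
  d% (fun q ↦ T q (Y q) (Z q)) p x
    - T p (g.leviCivita Y p x) (Z p) - T p (Y p) (g.leviCivita Z p x)

end PseudoRiemannianMetric

end PseudoRiemannian

section AlmostContact

/-- An almost contact B-metric structure `(φ, ξ, η, g)` on a smooth manifold `M` of dimension
`2n + 1`. -/
structure AlmostContactBMetric (n : ℕ) (M : Type*) [TopologicalSpace M]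
    [ChartedSpace (EuclideanSpace ℝ (Fin (2 * n + 1))) M] [IsManifold (𝓡 (2 * n + 1)) ∞ M] where
  g : PseudoRiemannianMetric (𝓡 (2 * n + 1)) M
  φ (p : M) : TangentSpace (𝓡 (2 * n + 1)) p →L[ℝ] TangentSpace (𝓡 (2 * n + 1)) p
  ξ (p : M) : TangentSpace (𝓡 (2 * n + 1)) p
  η (p : M) : TangentSpace (𝓡 (2 * n + 1)) p →L[ℝ] ℝ
  contMDiff_φ : ContMDiff (𝓡 (2 * n + 1)) ((𝓡 (2 * n + 1)).prod
      𝓘(ℝ, EuclideanSpace ℝ (Fin (2 * n + 1)) →L[ℝ] EuclideanSpace ℝ (Fin (2 * n + 1)))) ∞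
    (fun p ↦ TotalSpace.mk'
      (EuclideanSpace ℝ (Fin (2 * n + 1)) →L[ℝ] EuclideanSpace ℝ (Fin (2 * n + 1)))
      (E := fun p : M ↦
        (TangentSpace (𝓡 (2 * n + 1)) p →L[ℝ] TangentSpace (𝓡 (2 * n + 1)) p)) p (φ p))
  contMDiff_ξ : ContMDiff (𝓡 (2 * n + 1)) (𝓡 (2 * n + 1)).tangent ∞
    (fun p ↦ (⟨p, ξ p⟩ : TangentBundle (𝓡 (2 * n + 1)) M))
  contMDiff_η : ContMDiff (𝓡 (2 * n + 1)) ((𝓡 (2 * n + 1)).prod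
      𝓘(ℝ, EuclideanSpace ℝ (Fin (2 * n + 1)) →L[ℝ] ℝ)) ∞
    (fun p ↦ TotalSpace.mk' (EuclideanSpace ℝ (Fin (2 * n + 1)) →L[ℝ] ℝ)
      (E := fun p : M ↦ (TangentSpace (𝓡 (2 * n + 1)) p →L[ℝ] ℝ)) p (η p))
  signature : g.HasSignature (n + 1) n
  φ_ξ (p : M) : φ p (ξ p) = 0
  φ_φ (p : M) (x : TangentSpace (𝓡 (2 * n + 1)) p) : φ p (φ p x) = -x + η p x • ξ p
  η_φ (p : M) (x : TangentSpace (𝓡 (2 * n + 1)) p) : η p (φ p x) = 0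
  η_ξ (p : M) : η p (ξ p) = 1
  g_φ_φ (p : M) (x y : TangentSpace (𝓡 (2 * n + 1)) p) :
    g.inner p (φ p x) (φ p y) = -g.inner p x y + η p x * η p y

namespace AlmostContactBMetric

variable {n : ℕ} {M : Type*} [TopologicalSpace M]
  [ChartedSpace (EuclideanSpace ℝ (Fin (2 * n + 1))) M] [IsManifold (𝓡 (2 * n + 1)) ∞ M]
  (S : AlmostContactBMetric n M)

/-- The associated metric `g̃(x, y) = g(x, φ y) + η(x) η(y)`. -/
def assocMetric (p : M) (x y : TangentSpace (𝓡 (2 * n + 1)) p) : ℝ :=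
  S.g.inner p x (S.φ p y) + S.η p x * S.η p y

/-- `M` is Einstein-like with constants `(a, b, c)`: its Ricci tensor is
`ρ = a g + b g̃ + c η ⊗ η`. -/
def IsEinsteinLike (a b c : ℝ) : Prop :=
  ∀ (p : M) (x y : TangentSpace (𝓡 (2 * n + 1)) p),
    S.g.ricci p x y = a * S.g.inner p x y + b * S.assocMetric p x y + c * (S.η p x * S.η p y)

end AlmostContactBMetric

end AlmostContact

end

namespace AlmostContactBMetric

variable {n : ℕ} {M : Type*} [TopologicalSpace M]
  [ChartedSpace (EuclideanSpace ℝ (Fin (2 * n + 1))) M] [IsManifold (𝓡 (2 * n + 1)) ∞ M]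
  (S : AlmostContactBMetric n M)

theorem inner_ξ_right (p : M) (x : TangentSpace (𝓡 (2 * n + 1)) p) :
    S.g.inner p x (S.ξ p) = S.η p x := by
  have h := S.g_φ_φ p x (S.ξ p)
  rw [S.φ_ξ, S.η_ξ, map_zero] at h
  linarith

theorem inner_ξ_left (p : M) (x : TangentSpace (𝓡 (2 * n + 1)) p) :
    S.g.inner p (S.ξ p) x = S.η p x := by
  rw [S.g.symm, S.inner_ξ_right]

/-- The endomorphism `φ` is self-adjoint with respect to the B-metric. -/
theorem inner_φ_left (p : M) (x y : TangentSpace (𝓡 (2 * n + 1)) p) :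
    S.g.inner p (S.φ p x) y = S.g.inner p x (S.φ p y) := by
  have h := S.g_φ_φ p x (S.φ p y)
  rw [S.φ_φ, S.η_φ, map_add, map_neg, map_smul, S.inner_ξ_right, S.η_φ, smul_zero] at h
  linarith

theorem mdifferentiableAt_φ {p : M} {Y : Π q : M, TangentSpace (𝓡 (2 * n + 1)) q}
    (hY : MDifferentiableAt (𝓡 (2 * n + 1)) (𝓡 (2 * n + 1)).tangent
      (fun q ↦ (⟨q, Y q⟩ : TangentBundle (𝓡 (2 * n + 1)) M)) p) :
    MDifferentiableAt (𝓡 (2 * n + 1)) (𝓡 (2 * n + 1)).tangent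
      (fun q ↦ (⟨q, S.φ q (Y q)⟩ : TangentBundle (𝓡 (2 * n + 1)) M)) p :=
  MDifferentiableAt.clm_bundle_apply (F₁ := EuclideanSpace ℝ (Fin (2 * n + 1)))
    (F₂ := EuclideanSpace ℝ (Fin (2 * n + 1)))
    (S.contMDiff_φ.mdifferentiableAt (by simp)) hY

theorem mdifferentiableAt_ξ (p : M) : MDifferentiableAt (𝓡 (2 * n + 1)) (𝓡 (2 * n + 1)).tangent
    (fun q ↦ (⟨q, S.ξ q⟩ : TangentBundle (𝓡 (2 * n + 1)) M)) p :=
  S.contMDiff_ξ.mdifferentiableAt (by simp)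

theorem mdifferentiableAt_η {p : M} {Y : Π q : M, TangentSpace (𝓡 (2 * n + 1)) q}
    (hY : MDifferentiableAt (𝓡 (2 * n + 1)) (𝓡 (2 * n + 1)).tangent
      (fun q ↦ (⟨q, Y q⟩ : TangentBundle (𝓡 (2 * n + 1)) M)) p) :
    MDifferentiableAt (𝓡 (2 * n + 1)) 𝓘(ℝ, ℝ) (fun q ↦ S.η q (Y q)) p := by
  simpa only [S.inner_ξ_left] using S.g.mdifferentiableAt_inner (S.mdifferentiableAt_ξ p) hY

theorem mvfderiv_η {p : M} {Y : Π q : M, TangentSpace (𝓡 (2 * n + 1)) q}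
    (hY : MDifferentiableAt (𝓡 (2 * n + 1)) (𝓡 (2 * n + 1)).tangent
      (fun q ↦ (⟨q, Y q⟩ : TangentBundle (𝓡 (2 * n + 1)) M)) p)
    (x : TangentSpace (𝓡 (2 * n + 1)) p) :
    mvfderiv (𝓡 (2 * n + 1)) (fun q ↦ S.η q (Y q)) p x
      = S.g.inner p (S.g.leviCivita S.ξ p x) (Y p) + S.η p (S.g.leviCivita Y p x) := by
  simpa only [S.inner_ξ_left] using S.g.leviCivita_metric (S.mdifferentiableAt_ξ p) hY x

variable {S} {a b c : ℝ}

theorem IsEinsteinLike.ricci_eq (hS : S.IsEinsteinLike a b c) (p : M)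
    (x y : TangentSpace (𝓡 (2 * n + 1)) p) :
    S.g.ricci p x y = a * S.g.inner p x y + b * S.g.inner p (S.φ p x) y
      + (b + c) * (S.η p x * S.η p y) := by
  rw [hS, assocMetric, S.inner_φ_left]
  ring

theorem IsEinsteinLike.covDerivBilin_ricci (hS : S.IsEinsteinLike a b c) {p : M}
    {Y Z : Π q : M, TangentSpace (𝓡 (2 * n + 1)) q}
    (hY : MDifferentiableAt (𝓡 (2 * n + 1)) (𝓡 (2 * n + 1)).tangent
      (fun q ↦ (⟨q, Y q⟩ : TangentBundle (𝓡 (2 * n + 1)) M)) p)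
    (hZ : MDifferentiableAt (𝓡 (2 * n + 1)) (𝓡 (2 * n + 1)).tangent
      (fun q ↦ (⟨q, Z q⟩ : TangentBundle (𝓡 (2 * n + 1)) M)) p)
    (x : TangentSpace (𝓡 (2 * n + 1)) p) :
    S.g.covDerivBilin S.g.ricci Y Z p x
      = b * S.g.inner p (S.g.covDerivEnd S.φ Y p x) (Z p)
        + (b + c) * (S.g.inner p (S.g.leviCivita S.ξ p x) (Y p) * S.η p (Z p)
          + S.g.inner p (S.g.leviCivita S.ξ p x) (Z p) * S.η p (Y p)) := by
  have hφY := S.mdifferentiableAt_φ hY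
  have hg := S.g.mdifferentiableAt_inner hY hZ
  have hgφ := S.g.mdifferentiableAt_inner hφY hZ
  have hηY := S.mdifferentiableAt_η hY
  have hηZ := S.mdifferentiableAt_η hZ
  have hη : MDifferentiableAt (𝓡 (2 * n + 1)) 𝓘(ℝ, ℝ)
      (fun q ↦ S.η q (Y q) * S.η q (Z q)) p := hηY.mul hηZ
  have hmul (r : ℝ) {f : M → ℝ} (hf : MDifferentiableAt (𝓡 (2 * n + 1)) 𝓘(ℝ, ℝ) f p) :
      MDifferentiableAt (𝓡 (2 * n + 1)) 𝓘(ℝ, ℝ) (fun q ↦ r * f q) p :=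
    mdifferentiableAt_const.mul hf
  have hadd : MDifferentiableAt (𝓡 (2 * n + 1)) 𝓘(ℝ, ℝ) (fun q ↦ a * S.g.inner q (Y q) (Z q)
      + b * S.g.inner q (S.φ q (Y q)) (Z q)) p := (hmul a hg).add (hmul b hgφ)
  have h : mvfderiv (𝓡 (2 * n + 1)) (fun q ↦ S.g.ricci q (Y q) (Z q)) p x
      = a * mvfderiv (𝓡 (2 * n + 1)) (fun q ↦ S.g.inner q (Y q) (Z q)) p x
        + b * mvfderiv (𝓡 (2 * n + 1)) (fun q ↦ S.g.inner q (S.φ q (Y q)) (Z q)) p x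
        + (b + c) * (S.η p (Y p) * mvfderiv (𝓡 (2 * n + 1)) (fun q ↦ S.η q (Z q)) p x
          + S.η p (Z p) * mvfderiv (𝓡 (2 * n + 1)) (fun q ↦ S.η q (Y q)) p x) := by
    simp only [hS.ricci_eq]
    rw [mvfderiv_fun_add hadd (hmul (b + c) hη), mvfderiv_fun_add (hmul a hg) (hmul b hgφ),
      mvfderiv_fun_mul mdifferentiableAt_const hg, mvfderiv_fun_mul mdifferentiableAt_const hgφ,
      mvfderiv_fun_mul mdifferentiableAt_const hη, mvfderiv_fun_mul hηY hηZ]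
    simp [mvfderiv_const]
    ring
  rw [PseudoRiemannianMetric.covDerivBilin, h, S.g.leviCivita_metric hY hZ,
    S.g.leviCivita_metric hφY hZ, S.mvfderiv_η hY, S.mvfderiv_η hZ, hS.ricci_eq, hS.ricci_eq,
    PseudoRiemannianMetric.covDerivEnd, map_sub, _root_.sub_apply]
  ring

end AlmostContactBMetric

theorem mainTheorem10 (n : ℕ) (M : Type*) [TopologicalSpace M]
    [ChartedSpace (EuclideanSpace ℝ (Fin (2 * n + 1))) M] [IsManifold (𝓡 (2 * n + 1)) ∞ M]
    (S : AlmostContactBMetric n M) (a b c : ℝ) (hS : S.IsEinsteinLike a b c) :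
    (∀ (p : M) (x y : TangentSpace (𝓡 (2 * n + 1)) p),
      S.g.ricci p (S.φ p x) (S.φ p y)
        = -S.g.ricci p x y + (a + b + c) * S.η p x * S.η p y) ∧
    (∀ (p : M) (x y : TangentSpace (𝓡 (2 * n + 1)) p),
      S.g.ricci p (S.φ p x) y = S.g.ricci p x (S.φ p y)) ∧
    (∀ (p : M) (x : TangentSpace (𝓡 (2 * n + 1)) p),
      S.g.ricci p (S.φ p x) (S.ξ p) = 0) ∧
    (∀ (p : M) (x : TangentSpace (𝓡 (2 * n + 1)) p),
      S.g.ricci p x (S.ξ p) = (a + b + c) * S.η p x) ∧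
    (∀ p : M, S.g.ricci p (S.ξ p) (S.ξ p) = a + b + c) ∧
    (∀ (p : M) (x : TangentSpace (𝓡 (2 * n + 1)) p)
      (y z : Π q : M, TangentSpace (𝓡 (2 * n + 1)) q),
      MDifferentiableAt (𝓡 (2 * n + 1)) (𝓡 (2 * n + 1)).tangent
        (fun q ↦ (⟨q, y q⟩ : TangentBundle (𝓡 (2 * n + 1)) M)) p →
      MDifferentiableAt (𝓡 (2 * n + 1)) (𝓡 (2 * n + 1)).tangent
        (fun q ↦ (⟨q, z q⟩ : TangentBundle (𝓡 (2 * n + 1)) M)) p →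
      S.g.covDerivBilin S.g.ricci y z p x
        = b * S.g.inner p (S.g.covDerivEnd S.φ y p x) (z p)
          + (b + c) * (S.g.inner p (S.g.leviCivita S.ξ p x) (y p) * S.η p (z p)
            + S.g.inner p (S.g.leviCivita S.ξ p x) (z p) * S.η p (y p))) := by
  refine ⟨fun p x y ↦ ?_, fun p x y ↦ ?_, fun p x ↦ ?_, fun p x ↦ ?_, fun p ↦ ?_,
    fun p x y z hy hz ↦ hS.covDerivBilin_ricci hy hz x⟩
  · rw [hS.ricci_eq, hS.ricci_eq, S.g_φ_φ, S.g_φ_φ, S.η_φ, S.η_φ]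
    ring
  · rw [hS.ricci_eq, hS.ricci_eq, S.inner_φ_left, S.inner_φ_left, S.η_φ, S.η_φ, S.inner_φ_left]
    ring
  · rw [hS.ricci_eq, S.inner_ξ_right, S.inner_ξ_right, S.η_φ, S.η_φ]
    ring
  · rw [hS.ricci_eq, S.inner_ξ_right, S.inner_ξ_right, S.η_φ, S.η_ξ]
    ring
  · rw [hS.ricci_eq, S.inner_ξ_right, S.inner_ξ_right, S.η_φ, S.η_ξ]
    ring
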